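/- Let $K$ be a number field with algebraic closure $\bar K$, let $M_K$ be its set of places, and let $S\subset M_K$ be a finite set containing all Archimedean places. Let $\mathrm{Rat}_2$ be the affine variety over $\bar K$ of quadratic rational maps $\phi:\mathbb P^1\to\mathbb P^1$, $\phi(X:Y)=(a_0X^2+a_1XY+a_2Y^2:b_0X^2+b_1XY+b_2Y^2)$, where the two forms have no common zero in $\bar K^2\setminus\{(0,0)\}$; it is identified with the open subset of $\mathbb P^5$ of those $(a_0:a_1:a_2:b_0:b_1:b_2)$ for which the resultant of the two forms is nonzero. The group $\mathrm{PGL}_2$ acts on $\mathrm{Rat}_2$ by conjugation, $\phi^f=f^{-1}\circ\phi\circ f$. Let $\mathcal A$ be the coordinate ring of $\mathrm{Rat}_2$, let $\mathcal M_2=\mathrm{Spec}(\mathcal A^{\mathrm{PGL}_2})$ be the moduli space of quadratic rational maps, and let $\langle\cdot\rangle:\mathrm{Rat}_2\to\mathcal M_2$ be the map induced by the inclusion $\mathcal A^{\mathrm{PGL}_2}\subset\mathcal A$. Let $\mathrm{Rat}_2(K)$ be the set of quadratic rational maps defined over $K$. For a non-Archimedean place $v$ of $K$ and $\psi\in\mathrm{Rat}_2(K)$,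 let $\tilde\psi_v$ be the rational map over the residue field of $v$ obtained by scaling the coefficients of $\psi$ so that all are $v$-integral and at least one is a $v$-unit, and reducing them modulo the maximal ideal. A map $\phi\in\mathrm{Rat}_2(K)$ has good reduction at $v$ if there is $f\in\mathrm{PGL}_2(K)$ such that $\psi=\phi^f$ satisfies $\deg(\tilde\psi_v)=2$. Let $\mathcal G_2(K,S)$ be the set of all points $\langle\phi\rangle\in\mathcal M_2$ for maps $\phi\in\mathrm{Rat}_2(K)$ having good reduction at all places $v\in M_K\setminus S$. Then $\mathcal G_2(K,S)$ is Zariski-dense in $\mathcal M_2$. -/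

import Mathlib

open scoped LinearAlgebra.Projectivization Matrix NumberField

namespace QuadRat

/-- A pair of binary quadratic forms `A = a₀X² + a₁XY + a₂Y²`, `B = b₀X² + b₁XY + b₂Y²`,
recorded as the matrix with rows `(a₀, a₁, a₂)` and `(b₀, b₁, b₂)`. -/
abbrev FormPair (F : Type*) := Matrix (Fin 2) (Fin 3) F

/-- The vector of quadratic monomials `(X², XY, Y²)`. -/
def monomials {R : Type*} [CommRing R] (x : Fin 2 → R) : Fin 3 → R :=
  ![x 0 ^ 2, x 0 * x 1, x 1 ^ 2]

/-- The map `(X, Y) ↦ (A(X, Y), B(X, Y))`. -/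
def evalForms {R : Type*} [CommRing R] (M : FormPair R) (x : Fin 2 → R) : Fin 2 → R :=
  M *ᵥ monomials x

/-- The two forms have no common zero over an algebraic closure other than `(0, 0)`, that is,
`(X : Y) ↦ (A : B)` is a rational map of degree `2`. -/
def IsQuadratic {F : Type*} [Field F] (M : FormPair F) : Prop :=
  ∀ x : Fin 2 → AlgebraicClosure F,
    evalForms (M.map (algebraMap F (AlgebraicClosure F))) x = 0 → x = 0

/-- The Sylvester matrix of the two forms. -/
def sylv {R : Type*} [CommRing R] (M : FormPair R) : Matrix (Fin 4) (Fin 4) R :=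
  !![M 0 0, M 0 1, M 0 2, 0;
     0, M 0 0, M 0 1, M 0 2;
     M 1 0, M 1 1, M 1 2, 0;
     0, M 1 0, M 1 1, M 1 2]

/-- The resultant of the two forms. -/
def res {R : Type*} [CommRing R] (M : FormPair R) : R := (sylv M).det

theorem res_eq {R : Type*} [CommRing R] (M : FormPair R) :
    res M = (M 0 0 * M 1 2 - M 0 2 * M 1 0) ^ 2
      - (M 0 0 * M 1 1 - M 0 1 * M 1 0) * (M 0 1 * M 1 2 - M 0 2 * M 1 1) := by
  simp [res, sylv, Matrix.det_succ_row_zero, Fin.sum_univ_succ, Fin.succAbove]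
  ring

theorem res_map {R R' : Type*} [CommRing R] [CommRing R'] (f : R →+* R') (M : FormPair R) :
    res (M.map f) = f (res M) := by
  simp [res_eq]

theorem res_smul {R : Type*} [CommRing R] (t : R) (M : FormPair R) :
    res (t • M) = t ^ 4 * res M := by
  simp [res_eq]; ring

theorem evalForms_coord {R : Type*} [CommRing R] (M : FormPair R) (x : Fin 2 → R)
    (i : Fin 2) : evalForms M x i
      = M i 0 * x 0 ^ 2 + M i 1 * (x 0 * x 1) + M i 2 * x 1 ^ 2 := by
  simp [evalForms, monomials, Matrix.mulVec, dotProduct, Fin.sum_univ_succ]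
  ring

theorem eq_zero_of_res_ne_zero {L : Type*} [Field L] (M : FormPair L) (h : res M ≠ 0)
    (x : Fin 2 → L) (hx : evalForms M x = 0) : x = 0 := by
  have h0 := congrFun hx 0
  have h1 := congrFun hx 1
  rw [evalForms_coord, Pi.zero_apply] at h0 h1
  have hv : sylv M *ᵥ ![x 0 ^ 3, x 0 ^ 2 * x 1, x 0 * x 1 ^ 2, x 1 ^ 3] = 0 := by
    ext i
    fin_cases i <;> simp [sylv, Matrix.mulVec, dotProduct, Fin.sum_univ_succ]
    · linear_combination x 0 * h0
    · linear_combination x 1 * h0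
    · linear_combination x 0 * h1
    · linear_combination x 1 * h1
  have := Matrix.eq_zero_of_mulVec_eq_zero h hv
  ext i
  fin_cases i
  · simpa using congrFun this 0
  · simpa using congrFun this 3

theorem exists_zero_form {L : Type*} [Field L] [IsAlgClosed L] (a b c : L) :
    ∃ x : Fin 2 → L, x ≠ 0 ∧ a * x 0 ^ 2 + b * (x 0 * x 1) + c * x 1 ^ 2 = 0 := by
  by_cases ha : a = 0
  · exact ⟨![1, 0], fun h => by simpa using congrFun h 0, by simp [ha]⟩
  · obtain ⟨z, hz⟩ := IsAlgClosed.exists_root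
      (Polynomial.C a * Polynomial.X ^ 2 + Polynomial.C b * Polynomial.X + Polynomial.C c)
      (by rw [Polynomial.degree_quadratic ha]; decide)
    refine ⟨![z, 1], fun h => by simpa using congrFun h 1, ?_⟩
    simpa using hz

theorem exists_zero_of_res_eq_zero {L : Type*} [Field L] [IsAlgClosed L] (M : FormPair L)
    (h : res M = 0) : ∃ x : Fin 2 → L, x ≠ 0 ∧ evalForms M x = 0 := by
  rw [res_eq] at h
  suffices ∃ x : Fin 2 → L, x ≠ 0 ∧
      M 0 0 * x 0 ^ 2 + M 0 1 * (x 0 * x 1) + M 0 2 * x 1 ^ 2 = 0 ∧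
      M 1 0 * x 0 ^ 2 + M 1 1 * (x 0 * x 1) + M 1 2 * x 1 ^ 2 = 0 by
    obtain ⟨x, hx, h0, h1⟩ := this
    refine ⟨x, hx, ?_⟩
    ext i
    fin_cases i
    · simpa [evalForms_coord] using h0
    · simpa [evalForms_coord] using h1
  generalize M 0 0 = a at *
  generalize M 0 1 = b at *
  generalize M 0 2 = c at *
  generalize M 1 0 = d at *
  generalize M 1 1 = e at *
  generalize M 1 2 = f at *
  by_cases hr : b * f - c * e = 0
  · by_cases hp : a * e - b * d = 0
    · have hq : a * f - c * d = 0 := by simpa [hr, hp] using h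
      by_cases h0 : a = 0 ∧ b = 0 ∧ c = 0
      · obtain ⟨rfl, rfl, rfl⟩ := h0
        obtain ⟨x, hx, hx'⟩ := exists_zero_form d e f
        exact ⟨x, hx, by simp, hx'⟩
      · obtain ⟨x, hx, hx'⟩ := exists_zero_form a b c
        refine ⟨x, hx, hx', ?_⟩
        have ha : a * (d * x 0 ^ 2 + e * (x 0 * x 1) + f * x 1 ^ 2) = 0 := by
          linear_combination d * hx' + x 0 * x 1 * hp + x 1 ^ 2 * hq
        have hb : b * (d * x 0 ^ 2 + e * (x 0 * x 1) + f * x 1 ^ 2) = 0 := by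
          linear_combination e * hx' - x 0 ^ 2 * hp + x 1 ^ 2 * hr
        have hc : c * (d * x 0 ^ 2 + e * (x 0 * x 1) + f * x 1 ^ 2) = 0 := by
          linear_combination f * hx' - x 0 ^ 2 * hq - x 0 * x 1 * hr
        by_contra hne
        exact h0 ⟨(mul_eq_zero.1 ha).resolve_right hne, (mul_eq_zero.1 hb).resolve_right hne,
          (mul_eq_zero.1 hc).resolve_right hne⟩
    · refine ⟨![-(a * f - c * d), a * e - b * d], fun h => hp (by simpa using congrFun h 1), ?_, ?_⟩
      · simp; linear_combination a * h
      · simp; linear_combination d * h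
  · refine ⟨![b * f - c * e, -(a * f - c * d)], fun h => hr (by simpa using congrFun h 0), ?_, ?_⟩
    · simp; linear_combination c * h
    · simp; linear_combination f * h

/-- Having no common zero is equivalent to the nonvanishing of the resultant. -/
theorem isQuadratic_iff {F : Type*} [Field F] (M : FormPair F) : IsQuadratic M ↔ res M ≠ 0 := by
  have hr : res (M.map (algebraMap F (AlgebraicClosure F))) ≠ 0 ↔ res M ≠ 0 := by
    rw [res_map]; simp
  rw [← hr]
  refine ⟨fun h h0 => ?_, fun h x hx => eq_zero_of_res_ne_zero _ h x hx⟩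
  obtain ⟨x, hx, hx'⟩ := exists_zero_of_res_eq_zero _ h0
  exact hx (h x hx')

theorem IsQuadratic.ne_zero {F : Type*} [Field F] {M : FormPair F} (h : IsQuadratic M) :
    M ≠ 0 := by
  rintro rfl
  exact (isQuadratic_iff _).1 h (by simp [res_eq])

/-- The set `Rat₂(F)` of quadratic rational maps defined over `F`, as a subset of `ℙ⁵(F)`. -/
def Rat2 (F : Type*) [Field F] : Type _ := {p : ℙ F (FormPair F) // IsQuadratic p.rep}

theorem isQuadratic_rep_iff {F : Type*} [Field F] (M : FormPair F) (h : M ≠ 0) :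
    IsQuadratic (Projectivization.mk F M h).rep ↔ IsQuadratic M := by
  obtain ⟨a, ha⟩ := Projectivization.exists_smul_eq_mk_rep F M h
  rw [← ha, isQuadratic_iff, isQuadratic_iff, Units.smul_def, res_smul]
  simp

/-- The rational map `(X : Y) ↦ (A(X, Y) : B(X, Y))`. -/
def Rat2.mk {F : Type*} [Field F] (M : FormPair F) (hM : IsQuadratic M) : Rat2 F :=
  ⟨Projectivization.mk F M hM.ne_zero, (isQuadratic_rep_iff M hM.ne_zero).2 hM⟩

/-- The matrix by which a linear substitution with matrix `g` acts on `(X², XY, Y²)`. -/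
def symSq {R : Type*} [CommRing R] (g : Matrix (Fin 2) (Fin 2) R) :
    Matrix (Fin 3) (Fin 3) R :=
  !![g 0 0 ^ 2, 2 * (g 0 0 * g 0 1), g 0 1 ^ 2;
     g 0 0 * g 1 0, g 0 0 * g 1 1 + g 0 1 * g 1 0, g 0 1 * g 1 1;
     g 1 0 ^ 2, 2 * (g 1 0 * g 1 1), g 1 1 ^ 2]

/-- The pair `(C, D) = g⁻¹ ∘ (A, B) ∘ g`, as a linear function of the coefficients of `(A, B)`. -/
def conjForms {F : Type*} [Field F] (g : GL (Fin 2) F) : FormPair F →ₗ[F] FormPair F where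
  toFun M := (g⁻¹ : GL (Fin 2) F).1 * M * symSq g.1
  map_add' M N := by rw [Matrix.mul_add, Matrix.add_mul]
  map_smul' t M := by simp

theorem evalForms_conjForms {F : Type*} [Field F] (g : GL (Fin 2) F) (M : FormPair F)
    (x : Fin 2 → F) :
    evalForms (conjForms g M) x = (g⁻¹ : GL (Fin 2) F).1 *ᵥ evalForms M (g.1 *ᵥ x) := by
  have h : symSq g.1 *ᵥ monomials x = monomials (g.1 *ᵥ x) := by
    ext i
    fin_cases i <;>
      simp [symSq, monomials, Matrix.mulVec, dotProduct, Fin.sum_univ_succ] <;> ring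
  simp only [evalForms, conjForms, LinearMap.coe_mk, AddHom.coe_mk, ← h, Matrix.mulVec_mulVec,
    Matrix.mul_assoc]

theorem res_conjForms {F : Type*} [Field F] (g : GL (Fin 2) F) (M : FormPair F) :
    res (conjForms g M) = g.1.det ^ 2 * res M := by
  have h1 : ∀ N : Matrix (Fin 2) (Fin 2) F, ∀ P : FormPair F, res (N * P) = N.det ^ 2 * res P := by
    intro N P
    simp [res_eq, Matrix.det_fin_two, Matrix.mul_apply, Fin.sum_univ_succ]
    ring
  have h2 : res (M * symSq g.1) = g.1.det ^ 4 * res M := by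
    simp [res_eq, Matrix.det_fin_two, Matrix.mul_apply, Fin.sum_univ_succ, symSq]
    ring
  have hd : (g⁻¹ : GL (Fin 2) F).1.det * g.1.det = 1 := by
    rw [← Matrix.det_mul]; simp
  have : conjForms g M = (g⁻¹ : GL (Fin 2) F).1 * (M * symSq g.1) := by
    change (g⁻¹ : GL (Fin 2) F).1 * M * symSq g.1 = _
    rw [Matrix.mul_assoc]
  rw [this, h1, h2]
  linear_combination (g.1.det ^ 2 * res M) * ((g⁻¹ : GL (Fin 2) F).1.det * g.1.det + 1) * hd

theorem symSq_mul {R : Type*} [CommRing R] (g h : Matrix (Fin 2) (Fin 2) R) :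
    symSq (g * h) = symSq g * symSq h := by
  ext i j
  fin_cases i <;> fin_cases j <;>
    simp [symSq, Matrix.mul_apply, Fin.sum_univ_succ] <;> ring

theorem conjForms_injective {F : Type*} [Field F] (g : GL (Fin 2) F) :
    Function.Injective (conjForms g) := by
  have h1 : symSq (1 : Matrix (Fin 2) (Fin 2) F) = 1 := by
    ext i j
    fin_cases i <;> fin_cases j <;> simp [symSq]
  have hs : symSq g.1 * symSq (g⁻¹ : GL (Fin 2) F).1 = 1 := by
    rw [← symSq_mul, ← h1]; congr 1; exact g.mul_inv
  have hg : g.1 * (g⁻¹ : GL (Fin 2) F).1 = 1 := g.mul_inv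
  apply Function.LeftInverse.injective
    (g := fun M => g.1 * M * symSq (g⁻¹ : GL (Fin 2) F).1)
  intro M
  change g.1 * ((g⁻¹ : GL (Fin 2) F).1 * M * symSq g.1) * symSq (g⁻¹ : GL (Fin 2) F).1 = M
  rw [Matrix.mul_assoc (g⁻¹ : GL (Fin 2) F).1, ← Matrix.mul_assoc g.1, hg, Matrix.one_mul,
    Matrix.mul_assoc, hs, Matrix.mul_one]

theorem isQuadratic_map_conjForms {F : Type*} [Field F] (g : GL (Fin 2) F)
    (p : ℙ F (FormPair F)) (hp : IsQuadratic p.rep) :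
    IsQuadratic (Projectivization.map (conjForms g) (conjForms_injective g) p).rep := by
  rw [← p.mk_rep, Projectivization.map_mk, isQuadratic_rep_iff, isQuadratic_iff, res_conjForms]
  exact mul_ne_zero (pow_ne_zero _ (Matrix.GeneralLinearGroup.det g).ne_zero)
    ((isQuadratic_iff _).1 hp)

/-- The conjugate `φ^f = f⁻¹ ∘ φ ∘ f`, where `f` is the automorphism of `ℙ¹` with matrix `g`. -/
def Rat2.conj {F : Type*} [Field F] (g : GL (Fin 2) F) (φ : Rat2 F) : Rat2 F :=
  ⟨Projectivization.map (conjForms g) (conjForms_injective g) φ.1,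
    isQuadratic_map_conjForms g φ.1 φ.2⟩

theorem Rat2.conj_mk {F : Type*} [Field F] (g : GL (Fin 2) F) (M : FormPair F)
    (hM : IsQuadratic M) (hM' : IsQuadratic (conjForms g M)) :
    Rat2.conj g (Rat2.mk M hM) = Rat2.mk (conjForms g M) hM' := rfl

/-- Two quadratic rational maps over `F` are `F`-isomorphic if they are conjugate by an element
of `PGL₂(F)`, equivalently, by the class of an element of `GL₂(F)`. -/
def Isomorphic {F : Type*} [Field F] (φ ψ : Rat2 F) : Prop :=
  ∃ g : GL (Fin 2) F, ψ = φ.conj g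

/-- Extension of scalars on coefficients. -/
def mapForms (F L : Type*) [Field F] [Field L] [Algebra F L] :
    FormPair F →ₛₗ[algebraMap F L] FormPair L where
  toFun M := M.map (algebraMap F L)
  map_add' M N := by ext; simp
  map_smul' t M := by ext; simp

theorem mapForms_injective (F L : Type*) [Field F] [Field L] [Algebra F L] :
    Function.Injective (mapForms F L) :=
  Matrix.map_injective (algebraMap F L).injective

theorem isQuadratic_map_mapForms (F L : Type*) [Field F] [Field L] [Algebra F L]
    (p : ℙ F (FormPair F)) (hp : IsQuadratic p.rep) :
    IsQuadratic (Projectivization.map (mapForms F L) (mapForms_injective F L) p).rep := by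
  rw [← p.mk_rep, Projectivization.map_mk, isQuadratic_rep_iff, isQuadratic_iff]
  change res (p.rep.map (algebraMap F L)) ≠ 0
  rw [res_map]
  simpa using (isQuadratic_iff _).1 hp

/-- The inclusion `Rat₂(F) → Rat₂(L)` for a field extension `L / F`. -/
def Rat2.baseChange {F : Type*} [Field F] (L : Type*) [Field L] [Algebra F L] (φ : Rat2 F) :
    Rat2 L :=
  ⟨Projectivization.map (mapForms F L) (mapForms_injective F L) φ.1,
    isQuadratic_map_mapForms F L φ.1 φ.2⟩

/-! ### The moduli space over an algebraically closed field -/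

/-- The function `h` on `Rat₂` is given by a quotient `P / Res ^ n`, where `P` is a homogeneous
polynomial in the six coefficients of the same degree `4n` as `Res ^ n`. -/
def IsRegularFun {k : Type*} [Field k] (h : Rat2 k → k) : Prop :=
  ∃ (n : ℕ) (P : MvPolynomial (Fin 2 × Fin 3) k), P.IsHomogeneous (4 * n) ∧
    ∀ (M : FormPair k) (hM : IsQuadratic M),
      h (Rat2.mk M hM) = MvPolynomial.eval (fun ij => M ij.1 ij.2) P / res M ^ n

/-- The resultant as a polynomial in the six coefficients. -/
noncomputable def resPoly (k : Type*) [Field k] : MvPolynomial (Fin 2 × Fin 3) k :=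
  res (Matrix.of fun i j => MvPolynomial.X (i, j))

theorem resPoly_isHomogeneous (k : Type*) [Field k] : (resPoly k).IsHomogeneous 4 := by
  have hX : ∀ i j, (MvPolynomial.X (i, j) : MvPolynomial (Fin 2 × Fin 3) k).IsHomogeneous 1 :=
    fun i j => MvPolynomial.isHomogeneous_X k (i, j)
  have h2 : ∀ i j i' j' a b a' b', (MvPolynomial.X (i, j) * MvPolynomial.X (i', j')
      - MvPolynomial.X (a, b) * MvPolynomial.X (a', b') :
        MvPolynomial (Fin 2 × Fin 3) k).IsHomogeneous 2 :=
    fun i j i' j' a b a' b' => ((hX i j).mul (hX i' j')).sub ((hX a b).mul (hX a' b'))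
  rw [resPoly, res_eq]
  exact ((h2 _ _ _ _ _ _ _ _).pow 2).sub ((h2 _ _ _ _ _ _ _ _).mul (h2 _ _ _ _ _ _ _ _))

theorem eval_resPoly {k : Type*} [Field k] (M : FormPair k) :
    MvPolynomial.eval (fun ij => M ij.1 ij.2) (resPoly k) = res M := by
  simp [resPoly, res_eq]

/-- The coordinate ring of the affine variety `Rat₂` over the algebraically closed field `k`, as
the ring of its regular functions. -/
def coordRing (k : Type*) [Field k] [IsAlgClosed k] : Subalgebra k (Rat2 k → k) where
  carrier := {h | IsRegularFun h}
  mul_mem' := by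
    rintro h h' ⟨n, P, hP, e⟩ ⟨n', P', hP', e'⟩
    refine ⟨n + n', P * P', ?_, fun M hM => ?_⟩
    · rw [mul_add]; exact hP.mul hP'
    · rw [Pi.mul_apply, e, e', map_mul, pow_add, div_mul_div_comm]
  add_mem' := by
    rintro h h' ⟨n, P, hP, e⟩ ⟨n', P', hP', e'⟩
    refine ⟨n + n', P * resPoly k ^ n' + resPoly k ^ n * P', ?_, fun M hM => ?_⟩
    · rw [mul_add]
      exact (hP.mul ((resPoly_isHomogeneous k).pow n')).add
        (((resPoly_isHomogeneous k).pow n).mul hP')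
    · have hr := (isQuadratic_iff M).1 hM
      rw [Pi.add_apply, e, e', map_add, map_mul, map_mul, map_pow, map_pow, eval_resPoly,
        div_add_div _ _ (pow_ne_zero _ hr) (pow_ne_zero _ hr), pow_add]
  algebraMap_mem' t := by
    refine ⟨0, MvPolynomial.C t, MvPolynomial.isHomogeneous_C _ _, fun M hM => ?_⟩
    simp

/-- The ring of `PGL₂`-invariants in the coordinate ring of `Rat₂`. -/
def invariantRing (k : Type*) [Field k] [IsAlgClosed k] : Subalgebra k (coordRing k) where
  carrier := {h | ∀ (g : GL (Fin 2) k) (φ : Rat2 k), h.1 (φ.conj g) = h.1 φ}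
  mul_mem' := by
    intro a b ha hb g φ
    change a.1 _ * b.1 _ = a.1 _ * b.1 _
    rw [ha g φ, hb g φ]
  add_mem' := by
    intro a b ha hb g φ
    change a.1 _ + b.1 _ = a.1 _ + b.1 _
    rw [ha g φ, hb g φ]
  algebraMap_mem' _ _ _ := rfl

/-- The moduli space `M₂ = Spec (𝒜 ^ PGL₂)`, with its Zariski topology. -/
abbrev M2 (k : Type*) [Field k] [IsAlgClosed k] : Type _ := PrimeSpectrum (invariantRing k)

/-- The `k`-point `φ` of `Rat₂`, as a point of the spectrum of the coordinate ring: the ideal of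
all regular functions that vanish at `φ`. -/
def Rat2.point {k : Type*} [Field k] [IsAlgClosed k] (φ : Rat2 k) :
    PrimeSpectrum (coordRing k) :=
  ⟨RingHom.ker ((Pi.evalRingHom (fun _ : Rat2 k => k) φ).comp (coordRing k).val.toRingHom),
    RingHom.ker_isPrime _⟩

/-- The point `⟨φ⟩` of `M₂`: the image of `φ` under the map `Rat₂ → M₂` induced by the inclusion
of the ring of invariants in the coordinate ring. -/
def Rat2.cls {k : Type*} [Field k] [IsAlgClosed k] (φ : Rat2 k) : M2 k :=
  PrimeSpectrum.comap (invariantRing k).val.toRingHom φ.point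

/-! ### Places and good reduction -/

/-- The places of a number field: the Archimedean ones and the non-Archimedean ones, the latter
given by the nonzero prime ideals of the ring of integers. -/
abbrev Place (K : Type*) [Field K] [NumberField K] : Type _ :=
  NumberField.InfinitePlace K ⊕ IsDedekindDomain.HeightOneSpectrum (𝓞 K)

/-- The ring `𝒪_v` of `v`-integral elements of `K`. -/
noncomputable abbrev localRing {K : Type*} [Field K] [NumberField K]
    (v : IsDedekindDomain.HeightOneSpectrum (𝓞 K)) : ValuationSubring K :=
  (v.valuation K).valuationSubring

/-- The reduction of `ψ` at `v` has degree `2`: if `ψ` is written with coefficients in `𝒪_v`, at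
least one of which is a unit, then the reduced coefficients define a quadratic rational map over
the residue field. (Such coefficients exist and are unique up to a common unit of `𝒪_v`.) -/
def ReductionHasDegreeTwo {K : Type*} [Field K] [NumberField K] (ψ : Rat2 K)
    (v : IsDedekindDomain.HeightOneSpectrum (𝓞 K)) : Prop :=
  ∃ (M : FormPair (localRing v)) (hM : IsQuadratic (M.map (localRing v).subtype)),
    (∃ i j, IsUnit (M i j)) ∧ ψ = Rat2.mk (M.map (localRing v).subtype) hM ∧
      IsQuadratic (M.map (IsLocalRing.residue (localRing v)))

/-- `φ` has good reduction at `v`: it is `K`-isomorphic to a map whose reduction at `v` has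
degree `2`. -/
def HasGoodReduction {K : Type*} [Field K] [NumberField K] (φ : Rat2 K)
    (v : IsDedekindDomain.HeightOneSpectrum (𝓞 K)) : Prop :=
  ∃ ψ : Rat2 K, Isomorphic φ ψ ∧ ReductionHasDegreeTwo ψ v

/-- The set of all points `⟨φ⟩` of `M₂` for maps `φ` in `Rat₂(K)` that have good reduction at all
non-Archimedean places outside `S`. -/
def goodReductionLocus (K : Type*) [Field K] [NumberField K] (S : Set (Place K)) :
    Set (M2 (AlgebraicClosure K)) :=
  {P | ∃ φ : Rat2 K, (∀ v, Sum.inr v ∉ S → HasGoodReduction φ v) ∧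
    P = (φ.baseChange (AlgebraicClosure K)).cls}

end QuadRat

namespace QuadRat

/-! ### Representatives and trivial conjugation. -/

section Conjugation

variable {F : Type*} [Field F]

/-! A quadratic map in characteristic zero has two distinct critical points. Moving them to 0 and ∞
turns it into a linear map N after the squaring map, and over an algebraically closed field N can be
scaled into SL₂ (`Rat2.exists_conj_eq_squareForms`). Hence SL₂ surjects onto conjugacy classes. For
N in SL₂(ℤ) the resultant is 1, so the map has good reduction at every finite place
(`hasGoodReduction_integralMap`). Moreover SL₂(ℤ) is Zariski-dense in SL₂
(`eval_eq_zero_of_forall_int`). An invariant function vanishing on these integral maps therefore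
vanishes on all of Rat₂, so the vanishing ideal of the locus is zero. -/

theorem Rat2.mk_rep (φ : Rat2 F) : Rat2.mk φ.1.rep φ.2 = φ :=
  Subtype.ext φ.1.mk_rep

theorem Rat2.mk_congr {M N : FormPair F} (h : M = N) (hM : IsQuadratic M) (hN : IsQuadratic N) :
    Rat2.mk M hM = Rat2.mk N hN := by
  subst h; rfl

theorem conjForms_one (M : FormPair F) : conjForms 1 M = M := by
  have h1 : symSq (1 : Matrix (Fin 2) (Fin 2) F) = 1 := by
    ext i j
    fin_cases i <;> fin_cases j <;> simp [symSq]
  simp [conjForms, h1]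

theorem Rat2.conj_one (φ : Rat2 F) : φ.conj 1 = φ := by
  conv_rhs => rw [← φ.mk_rep]
  conv_lhs => rw [← φ.mk_rep]
  rw [Rat2.conj_mk 1 φ.1.rep φ.2 (by rw [conjForms_one]; exact φ.2)]
  exact Rat2.mk_congr (conjForms_one _) _ _

theorem Rat2.mk_smul (M : FormPair F) (t : F) (hM : IsQuadratic M)
    (hM' : IsQuadratic (t • M)) : Rat2.mk (t • M) hM' = Rat2.mk M hM :=
  Subtype.ext ((Projectivization.mk_eq_mk_iff' F _ _ _ _).2 ⟨t, rfl⟩)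

end Conjugation

/-! ### Linear maps composed with squaring. -/

/-- The pair of forms `(aX² + bY², cX² + dY²)`, the composition of the linear map with matrix
`(a b; c d)` and the squaring map. -/
def squareForms {R : Type*} [CommRing R] (N : Matrix (Fin 2) (Fin 2) R) : FormPair R :=
  !![N 0 0, 0, N 0 1; N 1 0, 0, N 1 1]

/-- Without mixed terms only the square of the outer minor survives. So determinant 1 forces
resultant 1 over any ring, in particular over every residue field. -/
theorem res_squareForms {R : Type*} [CommRing R] (N : Matrix (Fin 2) (Fin 2) R) :
    res (squareForms N) = N.det ^ 2 := by
  simp [res_eq, squareForms, Matrix.det_fin_two]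

theorem squareForms_map {R R' : Type*} [CommRing R] [CommRing R'] (f : R →+* R')
    (N : Matrix (Fin 2) (Fin 2) R) : (squareForms N).map f = squareForms (N.map f) := by
  ext i j
  fin_cases i <;> fin_cases j <;> simp [squareForms]

theorem smul_squareForms {R : Type*} [CommRing R] (t : R) (N : Matrix (Fin 2) (Fin 2) R) :
    t • squareForms N = squareForms (t • N) := by
  ext i j
  fin_cases i <;> fin_cases j <;> simp [squareForms]

theorem isQuadratic_squareForms {F : Type*} [Field F] {N : Matrix (Fin 2) (Fin 2) F}
    (hN : N.det = 1) : IsQuadratic (squareForms N) := by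
  rw [isQuadratic_iff, res_squareForms, hN]; simp

/-! ### Normal form by moving the critical points to 0 and ∞. -/

section NormalForm

variable {k : Type*} [Field k]

/-- If the coordinate points `0` and `∞` are critical for `M`, then `M` has no mixed terms. -/
theorem eq_squareForms_of_minors_eq_zero {M : FormPair k} (hM : res M ≠ 0)
    (hp : M 0 0 * M 1 1 - M 0 1 * M 1 0 = 0) (hr : M 0 1 * M 1 2 - M 0 2 * M 1 1 = 0) :
    M = squareForms !![M 0 0, M 0 2; M 1 0, M 1 2] := by
  rw [res_eq, hp, zero_mul, sub_zero] at hM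
  have hq := pow_ne_zero_iff (two_ne_zero) |>.1 hM
  -- Expanding a 3×3 determinant with a repeated row gives a linear relation between the three
  -- minors; two of them vanish and the third is nonzero.
  have h0 : M 0 1 = 0 := (mul_eq_zero.1 (show M 0 1 * (M 0 0 * M 1 2 - M 0 2 * M 1 0) = 0 by
    linear_combination M 0 0 * hr + M 0 2 * hp)).resolve_right hq
  have h1 : M 1 1 = 0 := (mul_eq_zero.1 (show M 1 1 * (M 0 0 * M 1 2 - M 0 2 * M 1 0) = 0 by
    linear_combination M 1 0 * hr + M 1 2 * hp)).resolve_right hq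
  ext i j
  fin_cases i <;> fin_cases j <;> simp [squareForms, h0, h1]

/-- Under a linear substitution, the first minor becomes a multiple of the value of the Jacobian form
at the first column of `g`. -/
theorem first_minor_mul_symSq (e g : Matrix (Fin 2) (Fin 2) k) (M : FormPair k) :
    (e * M * symSq g) 0 0 * (e * M * symSq g) 1 1 - (e * M * symSq g) 0 1 * (e * M * symSq g) 1 0
      = e.det * g.det * ((M 0 0 * M 1 1 - M 0 1 * M 1 0) * g 0 0 ^ 2
        + 2 * (M 0 0 * M 1 2 - M 0 2 * M 1 0) * (g 0 0 * g 1 0)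
        + (M 0 1 * M 1 2 - M 0 2 * M 1 1) * g 1 0 ^ 2) := by
  simp [Matrix.mul_apply, Fin.sum_univ_succ, symSq, Matrix.det_fin_two]
  ring

/-- Under a linear substitution, the last minor becomes a multiple of the value of the Jacobian form
at the second column of `g`. -/
theorem last_minor_mul_symSq (e g : Matrix (Fin 2) (Fin 2) k) (M : FormPair k) :
    (e * M * symSq g) 0 1 * (e * M * symSq g) 1 2 - (e * M * symSq g) 0 2 * (e * M * symSq g) 1 1
      = e.det * g.det * ((M 0 0 * M 1 1 - M 0 1 * M 1 0) * g 0 1 ^ 2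
        + 2 * (M 0 0 * M 1 2 - M 0 2 * M 1 0) * (g 0 1 * g 1 1)
        + (M 0 1 * M 1 2 - M 0 2 * M 1 1) * g 1 1 ^ 2) := by
  simp [Matrix.mul_apply, Fin.sum_univ_succ, symSq, Matrix.det_fin_two]
  ring

/-- If the columns of `g` are critical points of `M`, then conjugation by `g` removes the mixed
terms. -/
theorem exists_conjForms_eq_squareForms_of_columns {M : FormPair k} (hM : res M ≠ 0)
    (g : GL (Fin 2) k)
    (h : ∀ j, (M 0 0 * M 1 1 - M 0 1 * M 1 0) * g.1 0 j ^ 2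
      + 2 * (M 0 0 * M 1 2 - M 0 2 * M 1 0) * (g.1 0 j * g.1 1 j)
      + (M 0 1 * M 1 2 - M 0 2 * M 1 1) * g.1 1 j ^ 2 = 0) :
    ∃ N, conjForms g M = squareForms N := by
  have hres : res (conjForms g M) ≠ 0 := by
    rw [res_conjForms]
    exact mul_ne_zero (pow_ne_zero _ (Matrix.GeneralLinearGroup.det g).ne_zero) hM
  have hconj : conjForms g M = (g⁻¹ : GL (Fin 2) k).1 * M * symSq g.1 := rfl
  have hfst := first_minor_mul_symSq (g⁻¹ : GL (Fin 2) k).1 g.1 M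
  have hlast := last_minor_mul_symSq (g⁻¹ : GL (Fin 2) k).1 g.1 M
  rw [← hconj, h, mul_zero] at hfst hlast
  exact ⟨_, eq_squareForms_of_minors_eq_zero hres hfst hlast⟩

/-- The critical points are the zeros of the Jacobian form pX² + 2qXY + rY², up to a factor, where
p, q, r are the minors of M. Since q² - pr is the resultant, which is nonzero, these zeros are
distinct and can serve as the columns of g. -/
theorem exists_conjForms_eq_squareForms [IsAlgClosed k] [CharZero k] {M : FormPair k}
    (hM : res M ≠ 0) : ∃ (g : GL (Fin 2) k) (N : _), conjForms g M = squareForms N := by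
  obtain ⟨s, hs⟩ := IsAlgClosed.exists_pow_nat_eq (res M) (n := 2) two_pos
  have hs0 : s ≠ 0 := by rintro rfl; exact hM (by simpa using hs.symm)
  rw [res_eq] at hs
  by_cases hp : M 0 0 * M 1 1 - M 0 1 * M 1 0 = 0
  · by_cases hr : M 0 1 * M 1 2 - M 0 2 * M 1 1 = 0
    · exact ⟨1, _, by rw [conjForms_one]; exact eq_squareForms_of_minors_eq_zero hM hp hr⟩
    · set p := M 0 0 * M 1 1 - M 0 1 * M 1 0 with hp'
      set q := M 0 0 * M 1 2 - M 0 2 * M 1 0 with hq'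
      set r := M 0 1 * M 1 2 - M 0 2 * M 1 1 with hr'
      -- The columns are the two zeros given by the quadratic formula, with s² = q² - pr, normalised
      -- by X = r.
      have hd : (!![r, r; -q + s, -q - s] : Matrix (Fin 2) (Fin 2) k).det ≠ 0 := by
        have : (!![r, r; -q + s, -q - s] : Matrix (Fin 2) (Fin 2) k).det = -2 * (r * s) := by
          rw [Matrix.det_fin_two_of]; ring
        rw [this]; simp [hr, hs0]
      refine ⟨Matrix.GeneralLinearGroup.mkOfDetNeZero _ hd,
        exists_conjForms_eq_squareForms_of_columns hM _ fun j => ?_⟩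
      rw [← hp', ← hq', ← hr']
      fin_cases j <;> simp [Matrix.GeneralLinearGroup.mkOfDetNeZero] <;>
        linear_combination r * hs
  · set p := M 0 0 * M 1 1 - M 0 1 * M 1 0 with hp'
    set q := M 0 0 * M 1 2 - M 0 2 * M 1 0 with hq'
    set r := M 0 1 * M 1 2 - M 0 2 * M 1 1 with hr'
    -- The same two zeros, now normalised by Y = p.
    have hd : (!![-q + s, -q - s; p, p] : Matrix (Fin 2) (Fin 2) k).det ≠ 0 := by
      have : (!![-q + s, -q - s; p, p] : Matrix (Fin 2) (Fin 2) k).det = 2 * (p * s) := by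
        rw [Matrix.det_fin_two_of]; ring
      rw [this]; simp [hp, hs0]
    refine ⟨Matrix.GeneralLinearGroup.mkOfDetNeZero _ hd,
      exists_conjForms_eq_squareForms_of_columns hM _ fun j => ?_⟩
    rw [← hp', ← hq', ← hr']
    fin_cases j <;> simp [Matrix.GeneralLinearGroup.mkOfDetNeZero] <;>
      linear_combination p * hs

/-- Over an algebraically closed field of characteristic zero, every quadratic rational map is
conjugate to the composition of an element of `SL₂` with the squaring map. -/
theorem Rat2.exists_conj_eq_squareForms [IsAlgClosed k] [CharZero k] (φ : Rat2 k) :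
    ∃ (g : GL (Fin 2) k) (N : Matrix (Fin 2) (Fin 2) k) (hN : N.det = 1),
      φ.conj g = Rat2.mk (squareForms N) (isQuadratic_squareForms hN) := by
  obtain ⟨g, N, h⟩ := exists_conjForms_eq_squareForms ((isQuadratic_iff _).1 φ.2)
  have hres : res (conjForms g φ.1.rep) ≠ 0 := by
    rw [res_conjForms]
    exact mul_ne_zero (pow_ne_zero _ (Matrix.GeneralLinearGroup.det g).ne_zero)
      ((isQuadratic_iff _).1 φ.2)
  have hQ := (isQuadratic_iff _).2 hres
  have hdet : N.det ≠ 0 := by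
    rw [h, res_squareForms] at hres
    exact fun h0 => hres (by simp [h0])
  -- Scaling N by t multiplies the determinant by t² without changing the projective map.
  obtain ⟨t, ht⟩ := IsAlgClosed.exists_pow_nat_eq N.det⁻¹ (n := 2) two_pos
  have hdet' : (t • N).det = 1 := by
    rw [Matrix.det_smul, Fintype.card_fin, ht, inv_mul_cancel₀ hdet]
  refine ⟨g, t • N, hdet', ?_⟩
  conv_lhs => rw [← φ.mk_rep]
  rw [Rat2.conj_mk g φ.1.rep φ.2 hQ, Rat2.mk_congr h hQ (h ▸ hQ)]
  have h2 := isQuadratic_squareForms hdet'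
  rw [Rat2.mk_congr (smul_squareForms t N).symm h2 (by rw [smul_squareForms]; exact h2)]
  exact (Rat2.mk_smul _ t _ _).symm

end NormalForm

/-! ### Zariski density of SL₂(ℤ) in SL₂. -/

section Density

/-- The product of four elementary matrices, alternately upper and lower unitriangular. -/
def elementaryProduct {R : Type*} [CommRing R] (x : Fin 4 → R) : Matrix (Fin 2) (Fin 2) R :=
  !![1, x 0; 0, 1] * !![1, 0; x 1, 1] * !![1, x 2; 0, 1] * !![1, 0; x 3, 1]

theorem det_elementaryProduct {R : Type*} [CommRing R] (x : Fin 4 → R) :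
    (elementaryProduct x).det = 1 := by
  simp [elementaryProduct, Matrix.det_fin_two_of]
  ring

theorem elementaryProduct_map {R R' : Type*} [CommRing R] [CommRing R'] (f : R →+* R')
    (x : Fin 4 → R) : (elementaryProduct x).map f = elementaryProduct (fun i => f (x i)) := by
  ext i j
  fin_cases i <;> fin_cases j <;> simp [elementaryProduct]

/-- A determinant-one matrix with nonzero lower left entry c is upper·lower·upper unitriangular,
with c as the middle parameter. The fourth factor is there to make that entry nonzero. -/
theorem exists_elementaryProduct_eq {k : Type*} [Field k] {N : Matrix (Fin 2) (Fin 2) k}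
    (hN : N.det = 1) : ∃ x, elementaryProduct x = N := by
  have hd := hN
  rw [Matrix.det_fin_two] at hd
  -- Subtracting w times the second column from the first; w = 0 or w = 1 works because the bottom
  -- row is nonzero.
  obtain ⟨w, hw⟩ : ∃ w, N 1 0 - w * N 1 1 ≠ 0 := by
    by_cases h : N 1 0 = 0
    · refine ⟨1, fun h' => ?_⟩
      have h1 : N 1 1 = 0 := by simpa [h] using h'
      simp [h, h1] at hd
    · exact ⟨0, by simpa using h⟩
  set c := N 1 0 - w * N 1 1 with hc
  obtain ⟨x, hx⟩ : ∃ x, x * c = N 0 0 - w * N 0 1 - 1 := ⟨_, div_mul_cancel₀ _ hw⟩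
  obtain ⟨z, hz⟩ : ∃ z, z * c = N 1 1 - 1 := ⟨_, div_mul_cancel₀ _ hw⟩
  have h01 : (1 + x * c) * z + x = N 0 1 := mul_right_cancel₀ hw (by
    linear_combination (1 + x * c) * hz + N 1 1 * hx + hd - N 0 1 * hc)
  refine ⟨![x, c, z, w], ?_⟩
  ext i j
  fin_cases i <;> fin_cases j <;> simp [elementaryProduct]
  · linear_combination hx + w * h01
  · exact h01
  · linear_combination w * hz + hc
  · linear_combination hz

theorem eval_bind₁ {k σ τ : Type*} [CommRing k] (x : τ → k) (f : σ → MvPolynomial τ k)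
    (P : MvPolynomial σ k) : MvPolynomial.eval x (MvPolynomial.bind₁ f P)
      = MvPolynomial.eval (fun i => MvPolynomial.eval x (f i)) P :=
  MvPolynomial.eval₂Hom_bind₁ _ _ _ _

/-- `SL₂(ℤ)` is Zariski-dense in `SL₂` in characteristic zero. -/
theorem eval_eq_zero_of_forall_int {k : Type*} [Field k] [CharZero k]
    (P : MvPolynomial (Fin 2 × Fin 2) k)
    (h : ∀ N : Matrix (Fin 2) (Fin 2) ℤ, N.det = 1 →
      MvPolynomial.eval (fun ij => (N ij.1 ij.2 : k)) P = 0)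
    {N : Matrix (Fin 2) (Fin 2) k} (hN : N.det = 1) :
    MvPolynomial.eval (fun ij => N ij.1 ij.2) P = 0 := by
  let E : Matrix (Fin 2) (Fin 2) (MvPolynomial (Fin 4) k) := elementaryProduct MvPolynomial.X
  let Q : MvPolynomial (Fin 4) k := MvPolynomial.bind₁ (fun ij => E ij.1 ij.2) P
  have hQ : ∀ x, MvPolynomial.eval x Q
      = MvPolynomial.eval (fun ij => elementaryProduct x ij.1 ij.2) P := by
    intro x
    have hE : ∀ i j, MvPolynomial.eval x (E i j) = elementaryProduct x i j := fun i j => by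
      have := congrFun (congrFun (elementaryProduct_map (MvPolynomial.eval x) MvPolynomial.X) i) j
      simpa using this
    simp only [Q, eval_bind₁, hE]
  -- Q is the pullback of P to affine 4-space. Integer parameters give matrices in SL₂(ℤ), so Q
  -- vanishes on ℤ⁴, a product of infinite subsets of k.
  have hQ0 : Q = 0 := by
    refine MvPolynomial.funext_set (fun _ => Set.range (Int.cast : ℤ → k))
      (fun _ => Set.infinite_range_of_injective Int.cast_injective) fun x hx => ?_
    choose y hy using fun i => hx i (Set.mem_univ i)
    obtain rfl : (fun i => (y i : k)) = x := funext hy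
    rw [hQ, map_zero, ← h (elementaryProduct y) (det_elementaryProduct y)]
    have := elementaryProduct_map (Int.castRingHom k) y
    simp only [eq_intCast] at this
    rw [← this]
    rfl
  obtain ⟨x, rfl⟩ := exists_elementaryProduct_eq hN
  rw [← hQ, hQ0, map_zero]

end Density

/-! ### Good reduction of the integral maps. -/

section GoodReduction

variable {K : Type*} [Field K]

theorem det_map_intCast {N : Matrix (Fin 2) (Fin 2) ℤ} (hN : N.det = 1) (R : Type*) [CommRing R] :
    (N.map (Int.castRingHom R)).det = 1 := by
  rw [← RingHom.mapMatrix_apply, ← RingHom.map_det, hN, map_one]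

/-- The rational map over `F` defined by an element of `SL₂(ℤ)` after the squaring map. -/
def integralMap (F : Type*) [Field F] (N : Matrix (Fin 2) (Fin 2) ℤ) (hN : N.det = 1) : Rat2 F :=
  Rat2.mk (squareForms (N.map (Int.castRingHom F)))
    (isQuadratic_squareForms (det_map_intCast hN F))

/-- No conjugation is needed: the integer coefficients are v-integral, and their reduction still
comes from a matrix of determinant 1. -/
theorem hasGoodReduction_integralMap [NumberField K] (N : Matrix (Fin 2) (Fin 2) ℤ)
    (hN : N.det = 1) (v : IsDedekindDomain.HeightOneSpectrum (𝓞 K)) :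
    HasGoodReduction (integralMap K N hN) v := by
  have hmap : ∀ {F : Type _} [Field F] (f : localRing v →+* F),
      (squareForms (N.map (Int.castRingHom (localRing v)))).map f
        = squareForms (N.map (Int.castRingHom F)) := fun f => by
    rw [squareForms_map, Matrix.map_map]
    congr 2
    ext; simp
  have hquad : ∀ {F : Type _} [Field F] (f : localRing v →+* F),
      IsQuadratic ((squareForms (N.map (Int.castRingHom (localRing v)))).map f) := fun f => by
    rw [hmap]; exact isQuadratic_squareForms (det_map_intCast hN _)
  refine ⟨_, ⟨1, (Rat2.conj_one _).symm⟩, squareForms (N.map (Int.castRingHom (localRing v))),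
    hquad _, ?_, Rat2.mk_congr (hmap _).symm _ _, hquad _⟩
  -- If no coefficient were a unit, the reduced pair of forms would be zero, hence not quadratic.
  by_contra! hu
  have hm : ∀ i j, squareForms (N.map (Int.castRingHom (localRing v))) i j
      ∈ IsLocalRing.maximalIdeal (localRing v) := fun i j =>
    (IsLocalRing.mem_maximalIdeal _).2 (hu i j)
  have h0 : (squareForms (N.map (Int.castRingHom (localRing v)))).map
      (IsLocalRing.residue (localRing v)) = 0 := by
    ext i j
    exact (IsLocalRing.residue_eq_zero_iff _).2 (hm i j)
  exact (hquad (IsLocalRing.residue (localRing v))).ne_zero h0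

theorem baseChange_integralMap (L : Type*) [Field L] [Algebra K L]
    (N : Matrix (Fin 2) (Fin 2) ℤ) (hN : N.det = 1) :
    (integralMap K N hN).baseChange L = integralMap L N hN := by
  have h : mapForms K L (squareForms (N.map (Int.castRingHom K)))
      = squareForms (N.map (Int.castRingHom L)) := by
    change (squareForms (N.map (Int.castRingHom K))).map (algebraMap K L) = _
    rw [squareForms_map, Matrix.map_map]
    congr 2
    ext; simp
  apply Subtype.ext
  change Projectivization.map (mapForms K L) (mapForms_injective K L)
    (Projectivization.mk K _ _) = Projectivization.mk L _ _
  rw [Projectivization.map_mk]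
  congr 1

end GoodReduction

/-! ### Vanishing of invariants and density in the moduli space. -/

/-- An invariant regular function that vanishes at all maps given by `SL₂(ℤ)` is zero. -/
theorem eq_zero_of_forall_integralMap {k : Type*} [Field k] [IsAlgClosed k] [CharZero k]
    (h : invariantRing k) (hz : ∀ N hN, h.1.1 (integralMap k N hN) = 0) : h = 0 := by
  obtain ⟨n, P, -, hP⟩ := h.1.2
  let Q : MvPolynomial (Fin 2 × Fin 2) k := MvPolynomial.bind₁
    (fun ij => squareForms (Matrix.of fun i j => MvPolynomial.X (i, j)) ij.1 ij.2) P
  have hQ : ∀ N : Matrix (Fin 2) (Fin 2) k, ∀ hN : N.det = 1,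
      h.1.1 (Rat2.mk (squareForms N) (isQuadratic_squareForms hN))
        = MvPolynomial.eval (fun ij => N ij.1 ij.2) Q := by
    intro N hN
    -- On SL₂ the denominator is 1, so the regular function restricts to a polynomial in the entries
    -- of N.
    rw [hP, res_squareForms, hN, one_pow, one_pow, div_one]
    have hE : ∀ i j, MvPolynomial.eval (fun ij : Fin 2 × Fin 2 => N ij.1 ij.2)
        (squareForms (Matrix.of fun i j => MvPolynomial.X (i, j)) i j) = squareForms N i j := by
      intro i j
      fin_cases i <;> fin_cases j <;> simp [squareForms]
    simp only [Q, eval_bind₁, hE]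
  have hvan : ∀ φ : Rat2 k, h.1.1 φ = 0 := by
    intro φ
    obtain ⟨g, N, hN, hφ⟩ := φ.exists_conj_eq_squareForms
    rw [← h.2 g φ, hφ, hQ N hN]
    refine eval_eq_zero_of_forall_int Q (fun N' hN' => ?_) hN
    rw [← hz N' hN', integralMap, hQ _ (det_map_intCast hN' k)]
    simp
  exact Subtype.ext (Subtype.ext (funext hvan))

end QuadRat

theorem theorem1 (K : Type*) [Field K] [NumberField K] (S : Set (QuadRat.Place K))
    (hfin : S.Finite) (harch : ∀ w : NumberField.InfinitePlace K, Sum.inl w ∈ S) :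
    Dense (QuadRat.goodReductionLocus K S) := by
  have hbot : PrimeSpectrum.vanishingIdeal (QuadRat.goodReductionLocus K S) = ⊥ := by
    refine (Submodule.eq_bot_iff _).2 fun h hh =>
      QuadRat.eq_zero_of_forall_integralMap h fun N hN => ?_
    rw [PrimeSpectrum.mem_vanishingIdeal] at hh
    have := hh _ ⟨QuadRat.integralMap K N hN,
      fun v _ => QuadRat.hasGoodReduction_integralMap N hN v, rfl⟩
    rw [QuadRat.baseChange_integralMap] at this
    -- Membership in the prime ideal ⟨φ⟩ is, by definition, vanishing at φ.
    exact this
  rw [dense_iff_closure_eq, ← PrimeSpectrum.zeroLocus_vanishingIdeal_eq_closure, hbot]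
  exact PrimeSpectrum.zeroLocus_bot
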